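/- Consider two agents and a finite set $M$ of $m$ indivisible items. A valuation is additive and given by nonnegative item values, $v(S)=\sum_{j\in S}v(j)$, and its maximin share is $\mu(v)=\max_{S_1\sqcup S_2=M}\min\{v(S_1),v(S_2)\}$. A learning-augmented mechanism with prediction space $\mathcal P$ (an arbitrary set) maps every pair of reported valuations $\mathbf r=(r_1,r_2)$ and every prediction $p\in\mathcal P$ to a partition $X(\mathbf r,p)=(X_1(\mathbf r,p),X_2(\mathbf r,p))$ of $M$. It is truthful if, for every prediction and every report of the other agent, no agent can increase the true value of the bundle she receives by misreporting her valuation. For $\alpha>0$ and a prediction function $f$ from valuation profiles to $\mathcal P$, it is $\alpha$-consistent with respect to $f$ if $v_i(X_i(\mathbf v,f(\mathbf v)))\ge\mu(v_i)/\alpha$ for all profiles $\mathbf v=(v_1,v_2)$ and $i=1,2$. For $\beta>0$, it is $\beta$-robust if $v_i(X_i(\mathbf v,p))\ge\mu(v_i)/\beta$ for all profiles $\mathbf v$, all $p\in\mathcal P$ and $i=1,2$; it has bounded robustness if it is $\beta$-robust for some finite $\beta$. **Theorem.** (1) Let $m\ge 5$, and let $\mathcal P$ be any prediction space and $f$ any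 prediction function. For every $\epsilon$ with $0<\epsilon<6/5$, no truthful learning-augmented mechanism for two agents and $m$ items is $(6/5-\epsilon)$-consistent with respect to $f$ and has bounded robustness. (2) Let $m=5$ and let both agents have the valuation $v=(1/2,1/2,1/3,1/3,1/3)$. Then $\mu(v)=1$, and for every truthful mechanism with bounded robustness and every prediction $p$, the allocation $X((v,v),p)$ gives exactly one of the two items of value $1/2$ to each agent, so that some agent receives a bundle of value at most $5/6$. -/

import Mathlib

open scoped NNReal

noncomputable section

namespace MMS

/-- An additive valuation over the finite set `M` of indivisible goods, given by the
(nonnegative) values of the single items. -/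
abbrev Valuation (M : Type*) := M → ℝ≥0

/-- A valuation profile (or a report profile) of `n` agents. -/
abbrev Profile (n : ℕ) (M : Type*) := Fin n → Valuation M

/-- An ordered partition of `M` into `n` (possibly empty) bundles, encoded by the map
that sends an item to the index of its bundle. -/
abbrev Allocation (n : ℕ) (M : Type*) := M → Fin n

variable {n : ℕ} {M P : Type*} [Fintype M]

/-- The `i`-th bundle of an allocation. -/
def bundle (A : Allocation n M) (i : Fin n) : Finset M :=
  Finset.univ.filter fun j => A j = i

/-- The value `v(S)` of a bundle `S` under the additive valuation `v`. -/
def value (v : Valuation M) (S : Finset M) : ℝ :=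
  ∑ j ∈ S, (v j : ℝ)

/-- The maximin share `μ^k` of a valuation: the maximum over all partitions of `M` into `k`
bundles of the minimum value of a bundle (for `k ≥ 1` both extrema are over finite nonempty
sets, hence attained). -/
def mms (k : ℕ) (v : Valuation M) : ℝ :=
  ⨆ S : Allocation k M, ⨅ j : Fin k, value v (bundle S j)

/-- `(γ, k)`-approximate MMS allocation: `v_i(X_i) ≥ μ_i^k / γ` for every agent `i`.
The factor is only required to be positive, so that exact MMS allocations (`γ = 1`)
are included. -/
def IsApproxMMS (γ : ℝ) (k : ℕ) (v : Profile n M) (A : Allocation n M) : Prop :=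
  0 < γ ∧ ∀ i, mms k (v i) / γ ≤ value (v i) (bundle A i)

variable (n M P) in
/-- A learning-augmented mechanism with prediction space `P`: it maps the agents' reports and
a prediction to a partition of the items among the agents. -/
abbrev Mechanism := Profile n M → P → Allocation n M

/-- Truthfulness: whatever the prediction and the other agents' reports are, an agent with
valuation `vi` does not gain by reporting some `ri` instead. -/
def Truthful (X : Mechanism n M P) : Prop :=
  ∀ (i : Fin n) (r : Profile n M) (p : P) (vi ri : Valuation M),
    value vi (bundle (X (Function.update r i ri) p) i) ≤
      value vi (bundle (X (Function.update r i vi) p) i)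

/-- `α`-consistency with respect to the prediction function `f`. -/
def Consistent (X : Mechanism n M P) (f : Profile n M → P) (α : ℝ) : Prop :=
  ∀ v : Profile n M, IsApproxMMS α n v (X v (f v))

/-- `(β, k)`-robustness. -/
def Robust (X : Mechanism n M P) (β : ℝ) (k : ℕ) : Prop :=
  ∀ (v : Profile n M) (p : P), IsApproxMMS β k v (X v p)

/-- The mechanism is `β`-robust (i.e. `(β, n)`-robust) for some finite `β`. -/
def BoundedRobustness (X : Mechanism n M P) : Prop :=
  ∃ β : ℝ, Robust X β n

/-- The valuation `(1/2, 1/2, 1/3, 1/3, 1/3)` on five items; items `0` and `1` are large. -/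
def witness : Valuation (Fin 5) := ![1/2, 1/2, 1/3, 1/3, 1/3]

end MMS

end

/-
Fix a prediction and consider positive valuations. By truthfulness, an item that one agent values
above everything else together goes to an agent determined by the item alone: each item is
controlled by one of the two agents. Bounded robustness prevents an agent from ever receiving two
items she controls; otherwise she could insist on both, and an agent who values only these two items
would be left with nothing. Consequently an agent who insists on an item she controls gives up at
most one item she controls and at most one item controlled by the other agent, and a further report
of the other agent rules out that she gives up both. Since such an exchange cannot be profitable, an
agent who misses an item she controls holds an item worth at least as much. Hence two items that
both agents value above all others are separated. In the critical instance this means that the agent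
with at most one of the three small items gets at most `1/2 + 1/3 = 5/6` of her maximin share; for
more than five items, add items of value `δ → 0`.
-/

namespace MMS

section Valuation

variable {M : Type*} {u u' : Valuation M} {S T D : Finset M}

lemma value_mono (u : Valuation M) (h : S ⊆ T) : value u S ≤ value u T :=
  Finset.sum_le_sum_of_subset_of_nonneg h fun _ _ _ => NNReal.coe_nonneg _

lemma le_value_of_mem (u : Valuation M) {x : M} (h : x ∈ S) : (u x : ℝ) ≤ value u S :=
  Finset.single_le_sum (f := fun j => (u j : ℝ)) (fun _ _ => NNReal.coe_nonneg _) h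

lemma value_le_value_iff_sdiff [DecidableEq M] :
    value u S ≤ value u T ↔ value u (S \ T) ≤ value u (T \ S) := by
  simp only [value, ← Finset.sum_inter_add_sum_sdiff S T, ← Finset.sum_inter_add_sum_sdiff T S,
    Finset.inter_comm T S, add_le_add_iff_left]

lemma eq_of_value_le_of_value_le (h : value u T ≤ value u S) (h' : value u' S ≤ value u' T)
    (hup : ∀ j ∈ S, j ∉ T → u j < u' j) (hdown : ∀ j ∈ T, j ∉ S → u' j < u j) : T = S := by
  classical
  rw [value_le_value_iff_sdiff] at h h'
  have gain : ∀ j ∈ S \ T, (u j : ℝ) < u' j := by simpa using hup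
  have loss : ∀ j ∈ T \ S, (u' j : ℝ) < u j := by simpa using hdown
  have gain_le : value u (S \ T) ≤ value u' (S \ T) := Finset.sum_le_sum fun j hj => (gain j hj).le
  have loss_le : value u' (T \ S) ≤ value u (T \ S) := Finset.sum_le_sum fun j hj => (loss j hj).le
  apply Finset.Subset.antisymm
  · by_contra hne
    have := Finset.sum_lt_sum_of_nonempty (Finset.sdiff_nonempty.2 hne) loss
    unfold value at *
    linarith
  · by_contra hne
    have := Finset.sum_lt_sum_of_nonempty (Finset.sdiff_nonempty.2 hne) gain
    unfold value at *
    linarith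

lemma value_lt_value_of_subsingleton_sdiff {b : M} (hbT : b ∈ T) (hbS : b ∉ S) (hb : 0 < u b)
    (hlt : ∀ j ∈ S, j ∉ T → u j < u b) (hsub : (S \ T : Set M).Subsingleton) :
    value u S < value u T := by
  classical
  rw [← not_le, value_le_value_iff_sdiff, not_le]
  have hb_le : (u b : ℝ) ≤ value u (T \ S) := le_value_of_mem u (by simp [hbT, hbS])
  refine lt_of_lt_of_le ?_ hb_le
  obtain hempty | ⟨j, hj⟩ := (S \ T).eq_empty_or_nonempty
  · simpa [hempty, value] using hb
  · have hsingle : S \ T = {j} :=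
      Finset.eq_singleton_iff_unique_mem.2
        ⟨hj, fun l hl => hsub (by simpa using hl) (by simpa using hj)⟩
    rw [Finset.mem_sdiff] at hj
    simpa [hsingle, value] using hlt j hj.1 hj.2

/-- A valuation strongly desires a set of items if each of them is worth more than all items outside
the set together. The latter is expressed through arbitrary bundles of items outside the set. -/
def StronglyDesires (u : Valuation M) (D : Finset M) : Prop :=
  ∀ x ∈ D, ∀ S, Disjoint S D → value u S < u x

lemma StronglyDesires.subset_of_value_le (h : StronglyDesires u D) (hD : D ⊆ S)
    (hST : value u S ≤ value u T) : D ⊆ T := by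
  classical
  intro x hx
  by_contra hxT
  rw [value_le_value_iff_sdiff] at hST
  have hlt : value u (T \ S) < u x := h x hx _ (Finset.sdiff_disjoint.mono_right hD)
  have hle : (u x : ℝ) ≤ value u (S \ T) := le_value_of_mem u (by simp [hD hx, hxT])
  linarith

end Valuation

section Focus

variable {M : Type*} [Fintype M] {S D : Finset M} {u : Valuation M} {j : M}

open scoped Classical in
/-- The report by which an agent with valuation `u` and bundle `S` insists on the items of `D`: she
raises the other items of `S`, lowers the items outside `S`, and makes each item of `D` worth more
than all items outside `D` together. -/
noncomputable def focus (S D : Finset M) (u : Valuation M) : Valuation M := fun j =>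
  if j ∈ D then ∑ k, (u k + 1) else if j ∈ S then u j + 1 else u j / 2

lemma add_one_le_sum_add_one (u : Valuation M) (j : M) : u j + 1 ≤ ∑ k, (u k + 1) :=
  Finset.single_le_sum (f := fun k => u k + 1) (fun _ _ => zero_le) (Finset.mem_univ j)

lemma lt_focus (hj : j ∈ S) : u j < focus S D u j := by
  have hlt : u j < u j + 1 := lt_add_one _
  unfold focus
  split_ifs
  · exact hlt.trans_le (add_one_le_sum_add_one u j)
  · exact hlt

lemma focus_lt (hu : 0 < u j) (hjS : j ∉ S) (hjD : j ∉ D) : focus S D u j < u j := by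
  simpa only [focus, hjS, hjD, if_false] using NNReal.half_lt_self hu.ne'

lemma focus_pos (hu : ∀ j, 0 < u j) (j : M) : 0 < focus S D u j := by
  unfold focus
  split_ifs
  · exact (add_pos (hu j) one_pos).trans_le (add_one_le_sum_add_one u j)
  · exact add_pos (hu j) one_pos
  · exact half_pos (hu j)

lemma stronglyDesires_focus (S D : Finset M) (u : Valuation M) :
    StronglyDesires (focus S D u) D := by
  classical
  intro x hx T hT
  have hxT : x ∉ T := Finset.disjoint_right.1 hT hx
  have hle : ∀ j ∈ T, focus S D u j ≤ u j + 1 := fun j hj => by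
    have hjD : j ∉ D := Finset.disjoint_left.1 hT hj
    simp only [focus, hjD, if_false]
    split_ifs
    · exact le_rfl
    · exact (half_le_self zero_le).trans (le_add_of_nonneg_right zero_le)
  have hlt : ∑ j ∈ T, focus S D u j < ∑ k, (u k + 1) :=
    (Finset.sum_le_sum hle).trans_lt <|
      Finset.sum_lt_sum_of_subset T.subset_univ (Finset.mem_univ x) hxT
        (add_pos_of_nonneg_of_pos zero_le one_pos) fun _ _ _ => zero_le
  have hx_eq : focus S D u x = ∑ k, (u k + 1) := if_pos hx
  rw [value, hx_eq]
  exact_mod_cast hlt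

end Focus

section MaximinShare

variable {M : Type*} [Fintype M] {n : ℕ}

@[simp]
lemma mem_bundle {A : Allocation n M} {i : Fin n} {j : M} : j ∈ bundle A i ↔ A j = i := by
  simp [bundle]

variable [NeZero n]

lemma le_mms {v : Valuation M} {t : ℝ} (S : Allocation n M)
    (h : ∀ i, t ≤ value v (bundle S i)) : t ≤ mms n v :=
  (le_ciInf h).trans <|
    le_ciSup (f := fun S : Allocation n M => ⨅ i, value v (bundle S i))
      (Set.finite_range _).bddAbove S

lemma exists_value_bundle_le (v : Valuation M) (S : Allocation n M) :
    ∃ i, n * value v (bundle S i) ≤ value v Finset.univ := by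
  have hsum : ∑ i, value v (bundle S i) = value v Finset.univ :=
    Finset.sum_fiberwise Finset.univ S _
  by_contra! hlt
  have := Finset.sum_lt_sum_of_nonempty Finset.univ_nonempty fun i _ => hlt i
  rw [← Finset.mul_sum, hsum] at this
  simp at this

lemma mul_mms_le_value_univ (v : Valuation M) : n * mms n v ≤ value v Finset.univ := by
  have hn : (0 : ℝ) < n := Nat.cast_pos.2 (NeZero.pos n)
  rw [mul_comm, ← le_div_iff₀ hn]
  refine ciSup_le fun S => ?_
  obtain ⟨i, hi⟩ := exists_value_bundle_le v S
  refine (ciInf_le (Set.finite_range _).bddBelow i).trans ?_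
  rwa [le_div_iff₀ hn, mul_comm]

lemma mms_two_pos {v : Valuation M} {x y : M} (hxy : x ≠ y) (hx : 0 < v x) (hy : 0 < v y) :
    0 < mms 2 v := by
  classical
  have hmin : (0 : ℝ) < min (v x) (v y) := by exact_mod_cast lt_min hx hy
  refine hmin.trans_le (le_mms (fun j => if j = x then 0 else 1) ?_)
  rw [Fin.forall_fin_two]
  exact ⟨(min_le_left _ _).trans (le_value_of_mem v (by simp)),
    (min_le_right _ _).trans (le_value_of_mem v (by simp [hxy.symm]))⟩

end MaximinShare

section Truthful

open Function

variable {M P : Type*} {n : ℕ} {r : Profile n M} {i : Fin n}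

lemma forall_update_pos (hr : ∀ l j, 0 < r l j) {u : Valuation M} (hu : ∀ j, 0 < u j) :
    ∀ l j, 0 < update r i u l j :=
  (forall_update_iff r fun _ v => ∀ j, 0 < v j).2 ⟨hu, fun l _ => hr l⟩

variable [Fintype M] {X : Mechanism n M P} {p : P}

lemma Truthful.value_update_le (hX : Truthful X) (r : Profile n M) (p : P) (i : Fin n)
    (u : Valuation M) :
    value (r i) (bundle (X (update r i u) p) i) ≤ value (r i) (bundle (X r p) i) := by
  simpa using hX i r p (r i) u

lemma Truthful.value_le_update (hX : Truthful X) (r : Profile n M) (p : P) (i : Fin n)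
    (u : Valuation M) :
    value u (bundle (X r p) i) ≤ value u (bundle (X (update r i u) p) i) := by
  simpa using hX i r p u (r i)

lemma Truthful.bundle_update_eq (hX : Truthful X) {u : Valuation M}
    (hup : ∀ j, X r p j = i → r i j < u j)
    (hdown : ∀ j, X r p j ≠ i → X (update r i u) p j = i → u j < r i j) :
    bundle (X (update r i u) p) i = bundle (X r p) i :=
  eq_of_value_le_of_value_le (hX.value_update_le r p i u) (hX.value_le_update r p i u)
    (fun j hj _ => hup j (mem_bundle.1 hj))
    fun j hj hj' => hdown j (by simpa using hj') (mem_bundle.1 hj)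

lemma Truthful.apply_eq_of_stronglyDesires (hX : Truthful X) {x : M}
    (hx : StronglyDesires (r i) {x}) {u : Valuation M} (hu : X (update r i u) p x = i) :
    X r p x = i := by
  have := hx.subset_of_value_le (by simpa using hu) (hX.value_update_le r p i u)
  simpa using this

lemma BoundedRobustness.value_bundle_pos (hX : BoundedRobustness X) (r : Profile n M) (p : P)
    (i : Fin n) (h : 0 < mms n (r i)) : 0 < value (r i) (bundle (X r p) i) := by
  obtain ⟨β, hβ⟩ := hX
  obtain ⟨hβ_pos, happrox⟩ := hβ r p
  exact (div_pos h hβ_pos).trans_le (happrox i)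

/-- An agent controls an item, for a given prediction, if she receives it whenever she strongly
desires it. -/
def Controls (X : Mechanism n M P) (p : P) (i : Fin n) (x : M) : Prop :=
  ∀ r : Profile n M, StronglyDesires (r i) {x} → X r p x = i

end Truthful

section TwoAgents

open Function

variable {M P : Type*} [Fintype M] {X : Mechanism 2 M P} {r : Profile 2 M} {p : P} {i k : Fin 2}

lemma eq_of_ne_of_ne (hik : i ≠ k) {l : Fin 2} (hl : l ≠ i) : l = k := by
  omega

lemma eq_of_bundle_eq {A B : Allocation 2 M} (h : bundle A i = bundle B i) : A = B := by
  ext j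
  have : A j = i ↔ B j = i := by rw [← mem_bundle, h, mem_bundle]
  omega

lemma Truthful.apply_update_focus (hX : Truthful X) (hr : ∀ j, 0 < r i j) {D : Finset M}
    (hD : ∀ x ∈ D, X r p x = i) :
    X (update r i (focus (bundle (X r p) i) D (r i))) p = X r p :=
  eq_of_bundle_eq <| hX.bundle_update_eq (fun _ hj => lt_focus (mem_bundle.2 hj)) fun j hj _ =>
    focus_lt (hr j) (by simpa using hj) fun hjD => hj (hD j hjD)

lemma Truthful.exists_controls (hX : Truthful X) (p : P) (x : M) : ∃ i, Controls X p i x := by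
  classical
  set s : Valuation M := Pi.single x 1
  have hs : StronglyDesires s {x} := fun y hy S hS => by
    have hvalue : value s S = 0 := Finset.sum_eq_zero fun j hj => by
      have hjx : j ≠ x := by rintro rfl; simp [hj] at hS
      simp [s, hjx]
    simp [hvalue, s, Finset.mem_singleton.1 hy]
  obtain ⟨i, hi⟩ : ∃ i, X (fun _ => s) p x = i := ⟨_, rfl⟩
  refine ⟨i, fun r hr => ?_⟩
  obtain ⟨k, hki⟩ := exists_ne i
  have hprofile : update r k s = update (fun _ => s) i (r i) := by
    funext l
    obtain rfl | hl := eq_or_ne l i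
    · simp [hki.symm]
    · simp [eq_of_ne_of_ne hki.symm hl, hki]
  have hi' : X (update r k s) p x = i := by
    rw [hprofile]
    exact hX.apply_eq_of_stronglyDesires (u := s) (by simpa using hr) (by simpa using hi)
  by_contra hne
  have hk : X (update r k s) p x = k :=
    hX.apply_eq_of_stronglyDesires (u := r k) (by simpa using hs)
      (by simpa using eq_of_ne_of_ne hki.symm hne)
  exact hki (hk.symm.trans hi')

lemma Controls.apply_update_eq {x : M} (hc : Controls X p i x) (hX : Truthful X)
    (hr : ∀ l j, 0 < r l j) (hik : i ≠ k) {D : Finset M} (hD : ∀ y ∈ D, X r p y = i)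
    (hdes : StronglyDesires (r i) D) (hx : x ∈ D) (w : Valuation M) :
    X (update r k w) p x = i := by
  by_contra hw
  set v := focus (bundle (X r p) k) {x} (r k)
  set u := focus (bundle (X r p) i) {x} (r i)
  set r' := update r i u
  have hv : X (update r k v) p x = k :=
    hX.apply_eq_of_stronglyDesires (u := w) (by simpa using stronglyDesires_focus _ _ _)
      (by simpa using eq_of_ne_of_ne hik hw)
  have hr' : X r' p = X r p := hX.apply_update_focus (hr i) (by simpa using hD x hx)
  have hcomm : update r' k v = update (update r k v) i u := update_comm hik _ _ _
  have hx' : X (update r' k v) p x = i :=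
    hc _ (by simpa [hcomm] using stronglyDesires_focus _ _ _)
  -- `x` stays with agent `i`, so the report `v` only lowers items that agent `k` could gain.
  have hr'' : X (update r' k v) p = X r p := by
    refine (eq_of_bundle_eq (hX.bundle_update_eq (fun j hj => ?_) fun j hj hj' => ?_)).trans hr'
    · simpa [r', hik.symm] using lt_focus (mem_bundle.2 (hr' ▸ hj))
    · have hjx : j ≠ x := by rintro rfl; exact hik (hx'.symm.trans hj')
      simpa [r', hik.symm] using focus_lt (hr k j) (by simpa [hr'] using hj) (by simpa using hjx)
  have hvalue := hX.value_update_le (update r k v) p i u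
  rw [← hcomm, hr'', update_of_ne hik] at hvalue
  have hxv := hdes.subset_of_value_le (fun y hy => mem_bundle.2 (hD y hy)) hvalue hx
  exact hik ((mem_bundle.1 hxv).symm.trans hv)

lemma BoundedRobustness.apply_update_indicator (hX : BoundedRobustness X) (r : Profile 2 M) (p : P)
    (k : Fin 2) {x y : M} (hxy : x ≠ y) :
    ∃ j ∈ ({x, y} : Set M), X (update r k (Set.indicator {x, y} 1)) p j = k := by
  by_contra! h
  set w : Valuation M := Set.indicator {x, y} 1
  have hmms : 0 < mms 2 w := mms_two_pos hxy (by simp [w]) (by simp [w])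
  have hpos := hX.value_bundle_pos (update r k w) p k (by simpa using hmms)
  have hzero : value w (bundle (X (update r k w) p) k) = 0 := Finset.sum_eq_zero fun j hj => by
    have hj' : j ∉ ({x, y} : Set M) := fun hmem => h j hmem (mem_bundle.1 hj)
    simp only [w, Set.indicator_of_notMem hj', NNReal.coe_zero]
  simp [hzero] at hpos

lemma Controls.eq_of_apply_eq {x y : M} (hcx : Controls X p i x) (hX : Truthful X)
    (hβ : BoundedRobustness X) (hr : ∀ l j, 0 < r l j) (hcy : Controls X p i y)
    (hx : X r p x = i) (hy : X r p y = i) : x = y := by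
  classical
  by_contra hxy
  obtain ⟨k, hki⟩ := exists_ne i
  set u := focus (bundle (X r p) i) {x, y} (r i)
  have hpair : ∀ j ∈ ({x, y} : Finset M), X r p j = i := by simp [hx, hy]
  have hu : X (update r i u) p = X r p := hX.apply_update_focus (hr i) hpair
  obtain ⟨j, hj, hjk⟩ := hβ.apply_update_indicator (update r i u) p k hxy
  have hcj : Controls X p i j := by rcases hj with rfl | rfl <;> assumption
  have hpos : ∀ l j, 0 < update r i u l j := forall_update_pos hr (focus_pos (hr i))
  have hji := hcj.apply_update_eq hX hpos hki.symm (D := {x, y}) (by rwa [hu])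
    (by simpa using stronglyDesires_focus _ _ _) (by simpa using hj) (Set.indicator {x, y} 1)
  exact hki (hjk.symm.trans hji)

lemma Controls.exists_controls_apply_eq {z w : M} (hcz : Controls X p k z) (hX : Truthful X)
    (hβ : BoundedRobustness X) (hr : ∀ l j, 0 < r l j) (hik : i ≠ k) (hz : X r p z = k)
    (hcw : Controls X p i w) : ∃ x, Controls X p i x ∧ X r p x = i := by
  by_contra! hnone
  set v := focus (bundle (X r p) k) {z} (r k)
  set u := focus (bundle (X r p) i) {w} (r i)
  set r' := update r k v
  have hr' : X r' p = X r p := hX.apply_update_focus (hr k) (by simpa using hz)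
  have hw' : X (update r' i u) p w = i := hcw _ (by simpa using stronglyDesires_focus _ _ _)
  have hz' : X (update r' i u) p z = k :=
    hcz _ (by simpa [r', hik.symm] using stronglyDesires_focus _ _ _)
  have hkeep : ∀ j, X r p j = i → X (update r' i u) p j = i := fun j hj => by
    by_contra hj'
    obtain ⟨l, hcj⟩ := hX.exists_controls p j
    obtain rfl : l = k := eq_of_ne_of_ne hik (by rintro rfl; exact hnone j hcj hj)
    have hjz : j = z := hcj.eq_of_apply_eq hX hβ
      (forall_update_pos (forall_update_pos hr (focus_pos (hr l))) (focus_pos (hr i))) hcz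
      (eq_of_ne_of_ne hik hj') hz'
    exact hik (hj.symm.trans (hjz ▸ hz))
  have hgain : value (r i) (bundle (X r p) i) < value (r i) (bundle (X (update r' i u) p) i) :=
    value_lt_value_of_subsingleton_sdiff (mem_bundle.2 hw') (by simpa using hnone w hcw) (hr i w)
      (fun j hj hj' => absurd (hkeep j (mem_bundle.1 hj)) (by simpa using hj'))
      fun j hj => absurd (hkeep j (by simpa using hj.1)) (by simpa using hj.2)
  have hvalue := hX.value_update_le r' p i u
  rw [hr', show r' i = r i from update_of_ne hik _ _] at hvalue
  exact hgain.not_ge hvalue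

lemma Truthful.exists_controls_lost (hX : Truthful X) (hβ : BoundedRobustness X)
    (hr : ∀ l j, 0 < r l j) {u : Valuation M} (hu : ∀ j, 0 < u j) {b : M} (hb : X r p b ≠ i)
    (hb' : X (update r i u) p b = i) (hlt : ∀ j, X r p j = i → r i j < r i b) (l : Fin 2) :
    ∃ j, Controls X p l j ∧ X r p j = i ∧ X (update r i u) p j ≠ i := by
  by_contra! hnone
  obtain ⟨l', hl'⟩ := exists_ne l
  have hcontrols : ∀ j, X r p j = i → X (update r i u) p j ≠ i → Controls X p l' j := by
    intro j hj hj'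
    obtain ⟨a, hcj⟩ := hX.exists_controls p j
    obtain rfl : a = l' := eq_of_ne_of_ne hl'.symm (by rintro rfl; exact hj' (hnone j hcj hj))
    exact hcj
  have hsub : (bundle (X r p) i \ bundle (X (update r i u) p) i : Set M).Subsingleton := by
    rintro j ⟨hj, hj'⟩ m ⟨hm, hm'⟩
    simp only [Finset.mem_coe, mem_bundle] at hj hj' hm hm'
    have hcj := hcontrols j hj hj'
    have hcm := hcontrols m hm hm'
    obtain rfl | hil := eq_or_ne i l'
    · exact hcj.eq_of_apply_eq hX hβ hr hcm hj hm
    · exact hcj.eq_of_apply_eq hX hβ (forall_update_pos hr hu) hcm (eq_of_ne_of_ne hil hj')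
        (eq_of_ne_of_ne hil hm')
  have hgain : value (r i) (bundle (X r p) i) < value (r i) (bundle (X (update r i u) p) i) :=
    value_lt_value_of_subsingleton_sdiff (mem_bundle.2 hb') (by simpa using hb) (hr i b)
      (fun j hj _ => hlt j (mem_bundle.1 hj)) hsub
  exact hgain.not_ge (hX.value_update_le r p i u)

lemma Controls.exists_le_of_apply_ne {b : M} (hcb : Controls X p i b) (hX : Truthful X)
    (hβ : BoundedRobustness X) (hr : ∀ l j, 0 < r l j) (hb : X r p b ≠ i) :
    ∃ j, X r p j = i ∧ r i b ≤ r i j := by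
  by_contra! hlt
  obtain ⟨k, hki⟩ := exists_ne i
  set u := focus (bundle (X r p) i) {b} (r i)
  have hu : ∀ j, 0 < u j := focus_pos (hr i)
  have hbu (r' : Profile 2 M) : X (update r' i u) p b = i :=
    hcb _ (by simpa using stronglyDesires_focus _ _ _)
  have hlost := hX.exists_controls_lost hβ hr hu hb (hbu r) hlt
  obtain ⟨x, hcx, hx, -⟩ := hlost i
  obtain ⟨w, hcw, -⟩ := hlost k
  obtain ⟨y, hcy, hy⟩ := hcx.exists_controls_apply_eq hX hβ hr hki hx hcw
  -- Once agent `k` insists on `y`, agent `i` cannot lose any other item controlled by agent `k`.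
  set v := focus (bundle (X r p) k) {y} (r k)
  set r' := update r k v
  have hr' : X r' p = X r p := hX.apply_update_focus (hr k) (by simpa using hy)
  have hr'_pos : ∀ l j, 0 < r' l j := forall_update_pos hr (focus_pos (hr k))
  obtain ⟨z, hcz, hz, hz'⟩ := hX.exists_controls_lost hβ hr'_pos hu (by rwa [hr']) (hbu r')
    (by simpa [hr', r', hki.symm] using hlt) k
  have hy' : X (update r' i u) p y = k :=
    hcy _ (by simpa [r', hki] using stronglyDesires_focus _ _ _)
  have hzy : z = y := hcz.eq_of_apply_eq hX hβ (forall_update_pos hr'_pos hu) hcy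
    (eq_of_ne_of_ne hki.symm hz') hy'
  rw [hr', hzy, hy] at hz
  exact hki hz

theorem apply_ne_apply_of_forall_lt (hX : Truthful X) (hβ : BoundedRobustness X)
    (hr : ∀ l j, 0 < r l j) {a b : M} (hab : a ≠ b)
    (hlt : ∀ l j, j ≠ a → j ≠ b → r l j < r l a ∧ r l j < r l b) : X r p a ≠ X r p b := by
  intro heq
  obtain ⟨i, hi⟩ := exists_ne (X r p b)
  have controls_of_mem : ∀ c ∈ ({a, b} : Set M), Controls X p (X r p b) c := by
    intro c hc
    obtain ⟨l, hcl⟩ := hX.exists_controls p c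
    by_contra hne
    obtain rfl : l = i := eq_of_ne_of_ne hi.symm (by rintro rfl; exact hne hcl)
    have hcX : X r p c ≠ l := by rcases hc with rfl | rfl <;> simp [heq, hi.symm]
    obtain ⟨j, hj, hle⟩ := hcl.exists_le_of_apply_ne hX hβ hr hcX
    have hja : j ≠ a := by rintro rfl; exact hi (hj.symm.trans heq)
    have hjb : j ≠ b := by rintro rfl; exact hi hj.symm
    have hjlt : r l j < r l c := by
      rcases hc with rfl | rfl
      exacts [(hlt l j hja hjb).1, (hlt l j hja hjb).2]
    exact hjlt.not_ge hle
  exact hab ((controls_of_mem a (by simp)).eq_of_apply_eq hX hβ hr (controls_of_mem b (by simp))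
    heq rfl)

end TwoAgents

section Witness

lemma value_witness (S : Finset (Fin 5)) :
    value witness S = ((∑ j ∈ S, ![3, 3, 2, 2, 2] j : ℕ) : ℝ) / 6 := by
  have hwitness (j : Fin 5) : (witness j : ℝ) = ((![3, 3, 2, 2, 2] j : ℕ) : ℝ) / 6 := by
    fin_cases j <;> norm_num [witness]
  rw [value, Nat.cast_sum, Finset.sum_div]
  exact Finset.sum_congr rfl fun j _ => hwitness j

lemma exists_value_witness_le (A : Allocation 2 (Fin 5)) (h : A 0 ≠ A 1) :
    ∃ i, value witness (bundle A i) ≤ 5 / 6 := by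
  have hdecide : ∀ A : Allocation 2 (Fin 5), A 0 ≠ A 1 →
      ∃ i, ∑ j ∈ bundle A i, ![3, 3, 2, 2, 2] j ≤ 5 := by
    unfold bundle
    decide
  obtain ⟨i, hi⟩ := hdecide A h
  refine ⟨i, ?_⟩
  rw [value_witness]
  gcongr
  exact_mod_cast hi

lemma mms_witness : mms 2 witness = 1 := by
  apply le_antisymm
  · have hle := mul_mms_le_value_univ (n := 2) witness
    have htotal : ∑ j, ![3, 3, 2, 2, 2] j = 12 := by decide
    rw [value_witness, htotal] at hle
    norm_num at hle
    linarith
  · refine le_mms ![0, 0, 1, 1, 1] fun i => ?_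
    have hi : ∑ j ∈ bundle ![0, 0, 1, 1, 1] i, ![3, 3, 2, 2, 2] j = 6 := by
      unfold bundle
      decide +revert
    rw [value_witness, hi]
    norm_num

lemma witness_pos (j : Fin 5) : 0 < witness j := by
  fin_cases j <;> norm_num [witness]

lemma witness_lt_half {j : Fin 5} (h0 : j ≠ 0) (h1 : j ≠ 1) : witness j < 1 / 2 := by
  fin_cases j <;> first | contradiction | (rw [← NNReal.coe_lt_coe]; norm_num [witness])

end Witness

section Pad

variable {M N : Type*} (e : N ↪ M) (v : Valuation N) (δ : ℝ≥0)

/-- The valuation of a larger set of items that agrees with `v` along the embedding `e` and gives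
the value `δ` to each additional item. -/
noncomputable def pad (e : N ↪ M) (v : Valuation N) (δ : ℝ≥0) : Valuation M :=
  Function.extend e v fun _ => δ

lemma pad_apply (j : N) : pad e v δ (e j) = v j :=
  e.injective.extend_apply _ _ _

lemma pad_apply_of_notMem_range {j : M} (hj : j ∉ Set.range e) : pad e v δ j = δ :=
  Function.extend_apply' _ _ _ hj

lemma value_pad_map (S : Finset N) : value (pad e v δ) (S.map e) = value v S := by
  simp only [value, Finset.sum_map, pad_apply]

variable [Fintype M] [Fintype N] {n : ℕ}

lemma map_bundle_comp_subset (A : Allocation n M) (i : Fin n) :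
    (bundle (A ∘ e) i).map e ⊆ bundle A i := by
  simp [Finset.subset_iff]

lemma value_bundle_comp_le (A : Allocation n M) (i : Fin n) :
    value v (bundle (A ∘ e) i) ≤ value (pad e v δ) (bundle A i) := by
  rw [← value_pad_map e v δ]
  exact value_mono _ (map_bundle_comp_subset e A i)

lemma value_pad_bundle_le (A : Allocation n M) (i : Fin n) :
    value (pad e v δ) (bundle A i) ≤ value v (bundle (A ∘ e) i) + Fintype.card M * δ := by
  classical
  have hsplit := Finset.sum_sdiff (f := fun j => (pad e v δ j : ℝ)) (map_bundle_comp_subset e A i)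
  have hnew : ∀ j ∈ bundle A i \ (bundle (A ∘ e) i).map e, (pad e v δ j : ℝ) ≤ δ := by
    intro j hj
    rw [pad_apply_of_notMem_range]
    rintro ⟨l, rfl⟩
    simp at hj
  have hcard := Finset.sum_le_card_nsmul _ _ _ hnew
  rw [nsmul_eq_mul] at hcard
  calc
    value (pad e v δ) (bundle A i)
      = value (pad e v δ) (bundle A i \ (bundle (A ∘ e) i).map e) + value v (bundle (A ∘ e) i) := by
        rw [← value_pad_map e v δ]
        exact hsplit.symm
    _ ≤ Fintype.card M * δ + value v (bundle (A ∘ e) i) := by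
        gcongr
        refine hcard.trans ?_
        gcongr
        exact Finset.card_le_univ _
    _ = _ := add_comm _ _

lemma mms_le_mms_pad [NeZero n] : mms n v ≤ mms n (pad e v δ) := by
  refine ciSup_le fun A => ?_
  set B : Allocation n M := Function.extend e A fun _ => 0
  have hB : B ∘ e = A := funext fun j => e.injective.extend_apply A (fun _ => 0) j
  refine le_mms B fun i => ?_
  calc
    ⨅ l, value v (bundle A l) ≤ value v (bundle A i) := ciInf_le (Set.finite_range _).bddBelow i
    _ = value v (bundle (B ∘ e) i) := by rw [hB]
    _ ≤ value (pad e v δ) (bundle B i) := value_bundle_comp_le e v δ B i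

end Pad

section Consistency

open Filter Topology

variable {M P : Type*} [Fintype M] {X : Mechanism 2 M P}

lemma exists_value_pad_witness_le (hX : Truthful X) (hβ : BoundedRobustness X) (p : P)
    (e : Fin 5 ↪ M) {δ : ℝ≥0} (hδ : 0 < δ) (hδ' : δ < 1 / 2) :
    ∃ i, value (pad e witness δ) (bundle (X (fun _ => pad e witness δ) p) i) ≤
      5 / 6 + Fintype.card M * δ := by
  have hpos (j : M) : 0 < pad e witness δ j := by
    by_cases hj : j ∈ Set.range e
    · obtain ⟨k, rfl⟩ := hj
      simpa only [pad_apply] using witness_pos k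
    · rwa [pad_apply_of_notMem_range e _ _ hj]
  have hlt (j : M) (h0 : j ≠ e 0) (h1 : j ≠ e 1) : pad e witness δ j < 1 / 2 := by
    by_cases hj : j ∈ Set.range e
    · obtain ⟨k, rfl⟩ := hj
      rw [pad_apply]
      exact witness_lt_half (fun hk => h0 (congrArg e hk)) fun hk => h1 (congrArg e hk)
    · rwa [pad_apply_of_notMem_range e _ _ hj]
  have hsep : X (fun _ => pad e witness δ) p (e 0) ≠ X (fun _ => pad e witness δ) p (e 1) :=
    apply_ne_apply_of_forall_lt hX hβ (fun _ => hpos) (by simp) fun _ j h0 h1 => by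
      simpa [pad_apply, witness] using hlt j h0 h1
  obtain ⟨i, hi⟩ := exists_value_witness_le (X (fun _ => pad e witness δ) p ∘ e) hsep
  exact ⟨i, (value_pad_bundle_le e witness δ _ i).trans (by gcongr)⟩

theorem six_fifths_le_of_consistent (hM : 5 ≤ Fintype.card M) (hX : Truthful X)
    (hβ : BoundedRobustness X) {f : Profile 2 M → P} {α : ℝ} (hf : Consistent X f α) :
    6 / 5 ≤ α := by
  obtain ⟨e⟩ : Nonempty (Fin 5 ↪ M) :=
    Function.Embedding.nonempty_of_card_le (by simpa using hM)
  have hα : 0 < α := (hf fun _ => 0).1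
  have hbound : ∀ᶠ δ : ℝ≥0 in 𝓝[>] 0, 1 / α ≤ 5 / 6 + Fintype.card M * (δ : ℝ) := by
    filter_upwards [Ioo_mem_nhdsGT (by norm_num : (0 : ℝ≥0) < 1 / 2)] with δ hδ
    obtain ⟨i, hi⟩ :=
      exists_value_pad_witness_le hX hβ (f fun _ => pad e witness δ) e hδ.1 hδ.2
    have hmms : 1 ≤ mms 2 (pad e witness δ) := mms_witness ▸ mms_le_mms_pad e witness δ
    calc
      1 / α ≤ mms 2 (pad e witness δ) / α := by gcongr
      _ ≤ _ := (hf fun _ => pad e witness δ).2 i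
      _ ≤ _ := hi
  have hlimit : Tendsto (fun δ : ℝ≥0 => 5 / 6 + Fintype.card M * (δ : ℝ)) (𝓝[>] 0) (𝓝 (5 / 6)) :=
    tendsto_nhdsWithin_of_tendsto_nhds <| Continuous.tendsto' (by fun_prop) _ _ (by simp)
  have hle : 1 / α ≤ 5 / 6 := ge_of_tendsto hlimit hbound
  rw [div_le_iff₀ hα] at hle
  linarith

end Consistency

end MMS

theorem mainTheorem4 {M P : Type*} [Fintype M] :
    -- no truthful mechanism with consistency `6/5 - ε` and bounded robustness,
    -- for any prediction space, prediction function and any number `m ≥ 5` of items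
    (5 ≤ Fintype.card M → ∀ ε : ℝ, 0 < ε →
      ¬ ∃ (X : MMS.Mechanism 2 M P) (f : MMS.Profile 2 M → P),
          MMS.Truthful X ∧ MMS.Consistent X f (6 / 5 - ε) ∧ MMS.BoundedRobustness X) ∧
    -- the witness: both maximin shares are 1, the two large items are split,
    -- and some agent gets at most 5/6
    (MMS.mms 2 MMS.witness = 1 ∧
      ∀ X : MMS.Mechanism 2 (Fin 5) P, MMS.Truthful X → MMS.BoundedRobustness X →
        ∀ p : P,
          X (fun _ => MMS.witness) p 0 ≠ X (fun _ => MMS.witness) p 1 ∧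
          ∃ i : Fin 2,
            MMS.value MMS.witness (MMS.bundle (X (fun _ => MMS.witness) p) i) ≤ 5 / 6) := by
  refine ⟨?_, MMS.mms_witness, fun X hX hβ p => ?_⟩
  · rintro hM ε hε ⟨X, f, hX, hf, hβ⟩
    have := MMS.six_fifths_le_of_consistent hM hX hβ hf
    linarith
  · have hsep : X (fun _ => MMS.witness) p 0 ≠ X (fun _ => MMS.witness) p 1 :=
      MMS.apply_ne_apply_of_forall_lt hX hβ (fun _ => MMS.witness_pos) (by decide)
        fun _ j h0 h1 => by simpa [MMS.witness] using MMS.witness_lt_half h0 h1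
    exact ⟨hsep, MMS.exists_value_witness_le _ hsep⟩
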